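/- Let $p$ be a prime, let $r,s$ be positive integers, and let $A$ be a finite abelian group of exponent $M$ with $\gcd(p,|A|)=1$. Let $R=\mathrm{GR}(p^r,s)$ be the Galois ring, i.e. the Galois extension of $\mathbb{Z}/p^r\mathbb{Z}$ of degree $s$. Let $\mathcal T=\{0\}\cup\{x\in R: x^{p^s-1}=1\}$ be its Teichmüller set; every $\alpha\in R$ has a unique expansion $\alpha=\sum_{i=0}^{r-1}\alpha_i p^i$ with $\alpha_i\in\mathcal T$. If $s$ is even, put $\overline{\alpha}=\sum_{i=0}^{r-1}\alpha_i^{p^{s/2}}p^i$. An abelian code in $R[A]$ is an ideal of the group ring $R[A]$. It is Euclidean self-dual if it equals its dual with respect to the form $\langle u,v\rangle_{\rm E}=\sum_{g\in A}u_gv_g$ and (for $s$ even) Hermitian self-dual if it equals its dual with respect to $\langle u,v\rangle_{\rm H}=\sum_{g\in A}u_g\overline{v_g}$. Let $NEA(R[A])$ and $NHA(R[A])$ be the numbers of Euclidean and Hermitian self-dual abelian codes in $R[A]$. For positive integers $j$ and a prime power $q$, call $(j,q)$ oddly good if $j\mid q^t+1$ for some odd $t\ge 1$, evenly good if $j\mid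 q^t+1$ for some even $t\ge 2$, and good if it is oddly good or evenly good. Put $\chi(j,q)=0$ if $(j,q)$ is good and $1$ otherwise; put $\lambda(j,q)=0$ if $(j,q)$ is oddly good and $1$ otherwise. Let $\mathcal N_A(d)$ be the number of elements of order $d$ in $A$, and $\mathrm{ord}_d(q)$ the multiplicative order of $q$ modulo $d$. Then: 1. $NEA(R[A])=0$ if $r$ is odd, and if $r$ is even then $$NEA(R[A])=(1+r)^{\sum_{d\mid M}\chi(d,p^s)\frac{\mathcal N_A(d)}{2\,\mathrm{ord}_d(p^s)}},$$ where the exponent is a non-negative integer. 2. If $s$ is even, then $NHA(R[A])=0$ if $r$ is odd, and if $r$ is even then $$NHA(R[A])=(1+r)^{\sum_{d\mid M}\lambda(d,p^{s/2})\frac{\mathcal N_A(d)}{2\,\mathrm{ord}_d(p^s)}},$$ where the exponent is a non-negative integer. 3. Let $r$ be even. The code $p^{r/2}R[A]$ is the one and only Euclidean self-dual abelian code in $R[A]$ if and only if $(M,p^s)$ is good. If moreover $s$ is even, then $p^{r/2}R[A]$ is the one and only Hermitian self-dual abelian code in $R[A]$ if and only if $(M,p^{s/2})$ is oddly good. -/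

import Mathlib

open Polynomial

namespace AbelianCode

/-- `R` is the Galois ring `GR(p^r, s)`: the Galois extension `(ℤ/p^r)[X]/(f)` of degree `s` of
`ℤ/p^r`, where `f` is monic of degree `s` with irreducible reduction modulo `p`. Up to isomorphism
this does not depend on `f`. -/
def IsGaloisRing (p r s : ℕ) (R : Type*) [CommRing R] : Prop :=
  ∃ (h : p ∣ p ^ r) (f : (ZMod (p ^ r))[X]),
    f.Monic ∧ f.natDegree = s ∧ Irreducible (f.map (ZMod.castHom h (ZMod p))) ∧
      Nonempty (R ≃+* AdjoinRoot f)

/-- The Teichmüller set `{0, 1, ξ, …, ξ^(p^s - 2)}` of `GR(p^r, s)`: zero and the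
`(p^s - 1)`-st roots of unity (which form a cyclic group of order `p^s - 1` generated by `ξ`). -/
def teichmullerSet (p s : ℕ) (R : Type*) [CommRing R] : Set R :=
  {x | x = 0 ∨ x ^ (p ^ s - 1) = 1}

/-- `a` is the sequence of digits in the `p`-adic expansion
`α = a₀ + a₁ p + ⋯ + a_{r-1} p^{r-1}`, with all digits in the Teichmüller set. -/
def IsExpansion (p r s : ℕ) {R : Type*} [CommRing R] (α : R) (a : Fin r → R) : Prop :=
  (∀ i, a i ∈ teichmullerSet p s R) ∧ α = ∑ i, a i * (p : R) ^ (i : ℕ)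

open Classical in
/-- The conjugation `α ↦ a₀^(p^(s/2)) + a₁^(p^(s/2)) p + ⋯ + a_{r-1}^(p^(s/2)) p^(r-1)`, where
the `aᵢ` are the digits of the `p`-adic expansion of `α`. In `GR(p^r, s)` every element has exactly
one expansion, so the second branch is never taken there. -/
noncomputable def conj (p r s : ℕ) {R : Type*} [CommRing R] (α : R) : R :=
  if h : ∃ a : Fin r → R, IsExpansion p r s α a then
    ∑ i, (h.choose i) ^ (p ^ (s / 2)) * (p : R) ^ (i : ℕ)
  else 0

section Codes

variable {R : Type*} [CommRing R] {A : Type*} [AddCommGroup A] [Fintype A]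

/-- The Euclidean form `∑ g, u_g v_g` on `R[A]`. -/
def euclideanForm (u v : AddMonoidAlgebra R A) : R := ∑ g : A, u.coeff g * v.coeff g

/-- The Hermitian form `∑ g, u_g (conj v_g)` on `R[A]`. -/
noncomputable def hermitianForm (p r s : ℕ) (u v : AddMonoidAlgebra R A) : R :=
  ∑ g : A, u.coeff g * conj p r s (v.coeff g)

/-- An abelian code (an ideal of `R[A]`) is Euclidean self-dual if it equals its dual with respect
to the Euclidean form. -/
def IsEuclideanSelfDual (C : Ideal (AddMonoidAlgebra R A)) : Prop :=
  (C : Set (AddMonoidAlgebra R A)) = {v | ∀ u ∈ C, euclideanForm u v = 0}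

/-- An abelian code is Hermitian self-dual if it equals its dual with respect to the Hermitian
form. -/
def IsHermitianSelfDual (p r s : ℕ) (C : Ideal (AddMonoidAlgebra R A)) : Prop :=
  (C : Set (AddMonoidAlgebra R A)) = {v | ∀ u ∈ C, hermitianForm p r s u v = 0}

variable (R A)

/-- The number of Euclidean self-dual abelian codes in `R[A]`. -/
noncomputable def NEA : ℕ :=
  Nat.card {C : Ideal (AddMonoidAlgebra R A) // IsEuclideanSelfDual C}

/-- The number of Hermitian self-dual abelian codes in `R[A]`. -/
noncomputable def NHA (p r s : ℕ) : ℕ :=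
  Nat.card {C : Ideal (AddMonoidAlgebra R A) // IsHermitianSelfDual p r s C}

/-- The code `p^(r/2) R[A]`. -/
noncomputable def trivialCode (p r : ℕ) : Ideal (AddMonoidAlgebra R A) :=
  Ideal.span {(p : AddMonoidAlgebra R A) ^ (r / 2)}

end Codes

/-- `j` divides `q^t + 1` for some odd `t ≥ 1`. -/
def OddlyGood (j q : ℕ) : Prop := ∃ t, 1 ≤ t ∧ Odd t ∧ j ∣ q ^ t + 1

/-- `j` divides `q^t + 1` for some even `t ≥ 2`. -/
def EvenlyGood (j q : ℕ) : Prop := ∃ t, 2 ≤ t ∧ Even t ∧ j ∣ q ^ t + 1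

def Good (j q : ℕ) : Prop := OddlyGood j q ∨ EvenlyGood j q

open Classical in
noncomputable def chi (j q : ℕ) : ℕ := if Good j q then 0 else 1

open Classical in
noncomputable def lam (j q : ℕ) : ℕ := if OddlyGood j q then 0 else 1

/-- The number of elements of order `d` in `A`. -/
noncomputable def numOfOrder (A : Type*) [AddCommGroup A] (d : ℕ) : ℕ :=
  Nat.card {a : A // addOrderOf a = d}

/-- `ord_d(q)`, the multiplicative order of `q` modulo `d`. -/
noncomputable def ordMod (d q : ℕ) : ℕ := orderOf (q : ZMod d)

/-- `∑_{d ∣ M} χ(d, p^s) N_A(d) / (2 ord_d(p^s))`, where `M` is the exponent of `A`. -/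
noncomputable def euclideanExponent (A : Type*) [AddCommGroup A] (p s : ℕ) : ℚ :=
  ∑ d ∈ (AddMonoid.exponent A).divisors,
    (chi d (p ^ s) : ℚ) * ((numOfOrder A d : ℚ) / (2 * (ordMod d (p ^ s) : ℚ)))

/-- `∑_{d ∣ M} λ(d, p^(s/2)) N_A(d) / (2 ord_d(p^s))`, where `M` is the exponent of `A`. -/
noncomputable def hermitianExponent (A : Type*) [AddCommGroup A] (p s : ℕ) : ℚ :=
  ∑ d ∈ (AddMonoid.exponent A).divisors,
    (lam d (p ^ (s / 2)) : ℚ) * ((numOfOrder A d : ℚ) / (2 * (ordMod d (p ^ s) : ℚ)))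

end AbelianCode

/-! Put `q = p ^ s`. As `p ∤ |A|`, the quotient `R[A]/(p)` is a product of finite fields indexed by
the `q`-cyclotomic classes of `A`. Idempotents lift along the nilpotent ideal `(p)`, so `R[A]` is a
product of chain rings and an ideal amounts to an exponent `0 ≤ f O ≤ r` for each class `O`
(`exists_eq_idealOf`).

Both forms are `∑ u_g σ(v_g)` with `σ` a ring involution lifting the `p ^ h`-power map: `h = 0` in
the Euclidean case, `h = s / 2` in the Hermitian case. If `τ` applies `σ` to coefficients and
negates `A`, the dual of `C` is `{v | C * τ v = 0}` (`dual_eq`). Since `τ` carries the class of `a`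
to `t O`, the class of `-(p ^ h • a)`, self-duality reads `f O + f (t O) = r`. The class of `0` is
fixed by `t`, which excludes odd `r`; for even `r` a fixed class forces `r / 2`, and each 2-cycle of
`t` leaves `r + 1` choices.

The class of an element of order `d` has `ord_d(q)` members and is fixed exactly when `d ∣ q ^ i + p
^ h` for some `i`, which is goodness, respectively odd goodness. This gives the exponents.
Uniqueness means a zero exponent, which is decided at `d = M` because goodness passes to divisors.
-/

namespace AbelianCode

/-! ### Ideals and annihilators in a product of chain rings -/

/-- A finite family of evaluations of `S` in a field that identifies `S / π` with a product of
fields, where `π` is nilpotent of exact order `r` at each of them. -/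
structure ResidueSystem {S : Type*} [CommRing S] (π : S) (r : ℕ) (Q K : Type*) [DecidableEq Q]
    [Field K] where
  /-- the evaluations -/
  ev : Q → S →+* K
  ev_self : ∀ O, ev O π = 0
  dvd_of_ev : ∀ x, (∀ O, ev O x = 0) → π ∣ x
  pow_eq_zero : π ^ r = 0
  dvd_of_pow_mul : ∀ i ≤ r, ∀ x, π ^ i * x = 0 → π ^ (r - i) ∣ x
  exists_mul : ∀ O x, ev O x ≠ 0 → ∃ z, ∀ O', ev O' (z * x) = if O = O' then 1 else 0

namespace ResidueSystem

variable {S : Type*} [CommRing S] {π : S} {r : ℕ} {Q K : Type*} [DecidableEq Q] [Field K]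
  (D : ResidueSystem π r Q K)

include D

theorem isNilpotent_of_dvd {x : S} (h : π ∣ x) : IsNilpotent x :=
  ⟨r, by obtain ⟨y, rfl⟩ := h; rw [mul_pow, D.pow_eq_zero, zero_mul]⟩

theorem pow_eq_zero_of_le {k : ℕ} (h : r ≤ k) : π ^ k = 0 := by
  rw [← Nat.add_sub_cancel' h, pow_add, D.pow_eq_zero, zero_mul]

theorem ev_eq_zero_of_dvd {x : S} (h : π ∣ x) (O : Q) : D.ev O x = 0 := by
  obtain ⟨y, rfl⟩ := h
  rw [map_mul, D.ev_self, zero_mul]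

theorem eq_of_isIdempotentElem {e f : S} (he : IsIdempotentElem e) (hf : IsIdempotentElem f)
    (h : ∀ O, D.ev O e = D.ev O f) : e = f :=
  eq_of_isNilpotent_sub_of_isIdempotentElem he hf
    (D.isNilpotent_of_dvd (D.dvd_of_ev _ fun O => by rw [map_sub, h, sub_self]))

/-- An element with evaluations 0 and 1 is idempotent modulo the nilpotent ideal `(π)`, and
idempotents lift. -/
theorem exists_idem (O : Q) : ∃ e : S, IsIdempotentElem e ∧
    ∀ O', D.ev O' e = if O = O' then 1 else 0 := by
  obtain ⟨z, hz⟩ := D.exists_mul O 1 (by simp)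
  simp only [mul_one] at hz
  let f := Ideal.Quotient.mk (Ideal.span {π})
  have hf : ∀ x, f x = 0 ↔ π ∣ x := fun x => by
    rw [Ideal.Quotient.eq_zero_iff_mem, Ideal.mem_span_singleton]
  obtain ⟨e, he, hez⟩ := exists_isIdempotentElem_eq_of_ker_isNilpotent f
    (fun x hx => D.isNilpotent_of_dvd ((hf x).1 hx)) (f z) ⟨z, rfl⟩ (by
      rw [IsIdempotentElem, ← map_mul, ← sub_eq_zero, ← map_sub, hf]
      refine D.dvd_of_ev _ fun O' => ?_
      rw [map_sub, map_mul, hz]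
      split_ifs <;> simp)
  refine ⟨e, he, fun O' => ?_⟩
  rw [← hz, ← sub_eq_zero, ← map_sub]
  refine D.ev_eq_zero_of_dvd ((hf _).1 ?_) O'
  rw [map_sub, hez, sub_self]

/-- The primitive idempotent at `O`. -/
noncomputable def idem (O : Q) : S := (D.exists_idem O).choose

theorem isIdempotentElem_idem (O : Q) : IsIdempotentElem (D.idem O) := (D.exists_idem O).choose_spec.1

theorem ev_idem (O O' : Q) : D.ev O' (D.idem O) = if O = O' then 1 else 0 :=
  (D.exists_idem O).choose_spec.2 O'

theorem idem_mul_idem_of_ne {O O' : Q} (h : O ≠ O') : D.idem O * D.idem O' = 0 := by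
  refine D.eq_of_isIdempotentElem
    ((D.isIdempotentElem_idem O).mul (D.isIdempotentElem_idem O')) .zero fun P => ?_
  rw [map_mul, D.ev_idem, D.ev_idem, map_zero]
  rcases eq_or_ne O P with rfl | hP
  · rw [if_neg h.symm, mul_zero]
  · rw [if_neg hP, zero_mul]

theorem mem_of_idem_mul_mem [Fintype Q] {C : Ideal S} {x : S} (h : ∀ O, D.idem O * x ∈ C) :
    x ∈ C := by
  have hsum : ∑ O, D.idem O = 1 := by
    refine D.eq_of_isIdempotentElem ?_ .one fun O => ?_
    · rw [IsIdempotentElem, Finset.sum_mul]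
      refine Finset.sum_congr rfl fun O _ => ?_
      rw [Finset.mul_sum, Finset.sum_eq_single O (fun P _ hP => D.idem_mul_idem_of_ne hP.symm)
        (by simp)]
      exact D.isIdempotentElem_idem O
    · rw [map_sum, map_one]
      simp [D.ev_idem]
  rw [← one_mul x, ← hsum, Finset.sum_mul]
  exact C.sum_mem fun O _ => h O

/-- The ideal whose component at `O` is generated by `π ^ f O`. -/
def idealOf (f : Q → ℕ) : Ideal S where
  carrier := {x | ∀ O, π ^ f O ∣ D.idem O * x}
  add_mem' hx hy O := by rw [mul_add]; exact dvd_add (hx O) (hy O)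
  zero_mem' O := by simp
  smul_mem' c x hx O := by
    rw [smul_eq_mul, mul_left_comm]; exact (hx O).mul_left c

theorem mem_idealOf {f : Q → ℕ} {x : S} : x ∈ D.idealOf f ↔ ∀ O, π ^ f O ∣ D.idem O * x := Iff.rfl

theorem pow_mul_idem_mem_idealOf (f : Q → ℕ) (O : Q) : π ^ f O * D.idem O ∈ D.idealOf f := by
  intro P
  rcases eq_or_ne P O with rfl | h
  · exact (dvd_mul_right _ _).mul_left _
  · rw [mul_left_comm, D.idem_mul_idem_of_ne h, mul_zero]; exact dvd_zero _

/-- If `j < i`, multiplying by `π ^ (r - 1 - j)` gives `π ^ (r - 1) * e = 0`, hence `π ∣ e`,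
although `e` evaluates to 1 at `O`. -/
theorem le_of_pow_dvd_pow_mul_idem {i j : ℕ} {O : Q} (hi : i ≤ r)
    (h : π ^ i ∣ π ^ j * D.idem O) : i ≤ j := by
  by_contra! hij
  have h0 : π ^ (r - 1) * D.idem O = 0 := by
    obtain ⟨y, hy⟩ := h
    have : r - 1 = (r - 1 - j) + j := by omega
    rw [this, pow_add, mul_assoc, hy, ← mul_assoc, ← pow_add, D.pow_eq_zero_of_le (by omega),
      zero_mul]
  have h1 := D.dvd_of_pow_mul (r - 1) (by omega) _ h0
  rw [show r - (r - 1) = 1 by omega, pow_one] at h1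
  simpa [D.ev_idem] using D.ev_eq_zero_of_dvd h1 O

theorem idealOf_injOn {f g : Q → ℕ} (hf : ∀ O, f O ≤ r) (hg : ∀ O, g O ≤ r)
    (h : D.idealOf f = D.idealOf g) : f = g := by
  have key : ∀ {f g : Q → ℕ}, (∀ O, g O ≤ r) → D.idealOf f = D.idealOf g → ∀ O, g O ≤ f O := by
    intro f g hg h O
    have h1 := D.pow_mul_idem_mem_idealOf f O
    rw [h] at h1
    have h2 := h1 O
    rw [mul_left_comm, (D.isIdempotentElem_idem O).eq] at h2
    exact D.le_of_pow_dvd_pow_mul_idem (hg O) h2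
  funext O
  exact le_antisymm (key hf h.symm O) (key hg h O)

/-- The exponent at `O` is the least `i` with `π ^ i * e_O ∈ C`. -/
theorem exists_eq_idealOf [Fintype Q] (C : Ideal S) :
    ∃ f : Q → ℕ, (∀ O, f O ≤ r) ∧ C = D.idealOf f := by
  classical
  have hex : ∀ O, ∃ i, π ^ i * D.idem O ∈ C := fun O =>
    ⟨r, by rw [D.pow_eq_zero, zero_mul]; exact C.zero_mem⟩
  refine ⟨fun O => Nat.find (hex O), fun O => Nat.find_le (by
    rw [D.pow_eq_zero, zero_mul]; exact C.zero_mem), le_antisymm ?_ ?_⟩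
  · intro x hx O
    have key : ∀ i ≤ Nat.find (hex O), π ^ i ∣ D.idem O * x := by
      intro i
      induction i with
      | zero => simp
      | succ i ih =>
        intro hi
        obtain ⟨y, hy⟩ := ih (by omega)
        have hy' : D.idem O * x = π ^ i * (D.idem O * y) := by
          rw [mul_left_comm, ← hy, ← mul_assoc, (D.isIdempotentElem_idem O).eq]
        have hy0 : D.ev O y = 0 := by
          -- Otherwise `y` is invertible on the component of `O`: `z * y = e_O + π * w` and `1 + π *
          -- w` is a unit, so `π ^ i * e_O` already lies in `C`, against minimality.
          by_contra hne
          obtain ⟨z, hz⟩ := D.exists_mul O y hne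
          obtain ⟨w, hw⟩ : π ∣ z * y - D.idem O := D.dvd_of_ev _ fun O' => by
            rw [map_sub, hz, D.ev_idem, sub_self]
          obtain ⟨u, hu⟩ := ((D.isNilpotent_of_dvd (dvd_mul_right π w)).isUnit_one_add)
          refine Nat.find_min (hex O) (m := i) (by omega) ?_
          have h1 : z * (D.idem O * x) = u * (π ^ i * D.idem O) := by
            rw [hy', hu]
            have he := (D.isIdempotentElem_idem O).eq
            linear_combination (π ^ i * D.idem O) * hw + π ^ i * he
          have h2 : π ^ i * D.idem O = (↑u⁻¹ * z * D.idem O) * x := by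
            rw [mul_assoc, mul_assoc, h1, Units.inv_mul_cancel_left]
          rw [h2]
          exact C.mul_mem_left _ hx
        obtain ⟨w, hw⟩ : π ∣ D.idem O * y := D.dvd_of_ev _ fun O' => by
          rw [map_mul, D.ev_idem]
          split_ifs with h
          · rw [← h, hy0, mul_zero]
          · rw [zero_mul]
        exact ⟨w, by rw [hy', hw, pow_succ, mul_assoc]⟩
    exact key _ le_rfl
  · intro x hx
    refine D.mem_of_idem_mul_mem fun O => ?_
    obtain ⟨y, hy⟩ := hx O
    have : D.idem O * x = y * (π ^ Nat.find (hex O) * D.idem O) := by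
      linear_combination D.idem O * hy - x * (D.isIdempotentElem_idem O).eq
    rw [this]
    exact C.mul_mem_left _ (Nat.find_spec (hex O))

theorem idealOf_const [Fintype Q] (k : ℕ) : D.idealOf (fun _ => k) = Ideal.span {π ^ k} := by
  ext x
  refine ⟨fun h => D.mem_of_idem_mul_mem fun O => Ideal.mem_span_singleton.2 (h O), fun h O => ?_⟩
  exact (Ideal.mem_span_singleton.1 h).mul_left _

theorem forall_mul_eq_zero_iff [Fintype Q] {f : Q → ℕ} (hf : ∀ O, f O ≤ r) (y : S) :
    (∀ x ∈ D.idealOf f, x * y = 0) ↔ y ∈ D.idealOf fun O => r - f O := by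
  refine ⟨fun h O => ?_, fun h x hx => ?_⟩
  · refine D.dvd_of_pow_mul _ (hf O) _ ?_
    rw [← mul_assoc]
    exact h _ (D.pow_mul_idem_mem_idealOf f O)
  · rw [← Ideal.mem_bot]
    refine D.mem_of_idem_mul_mem fun O => ?_
    obtain ⟨a, ha⟩ := hx O
    obtain ⟨b, hb⟩ := h O
    have h0 : π ^ f O * π ^ (r - f O) = 0 := by
      rw [← pow_add, Nat.add_sub_cancel' (hf O), D.pow_eq_zero]
    rw [Ideal.mem_bot, ← (D.isIdempotentElem_idem O).eq, mul_mul_mul_comm, ha, hb, mul_mul_mul_comm,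
      h0, zero_mul]

section Involution

variable {τ : S →+* S} (hτ : ∀ x, τ (τ x) = x) {t : Q → Q} (ht : ∀ O, t (t O) = O)
  (hev : ∀ O x, D.ev (t O) (τ x) = 0 ↔ D.ev O x = 0)

include ht hev

/-- Idempotents evaluate to 0 or 1 and are determined by these values, so compatibility of `τ` with
mere vanishing suffices. -/
theorem map_idem (O : Q) : τ (D.idem O) = D.idem (t O) := by
  have hid : IsIdempotentElem (τ (D.idem O)) := (D.isIdempotentElem_idem O).map τ
  refine D.eq_of_isIdempotentElem hid (D.isIdempotentElem_idem _) fun P => ?_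
  have h01 : D.ev P (τ (D.idem O)) = 0 ∨ D.ev P (τ (D.idem O)) = 1 :=
    IsIdempotentElem.iff_eq_zero_or_one.1 (hid.map (D.ev P))
  have h0 := hev (t P) (D.idem O)
  rw [ht, D.ev_idem] at h0
  rw [D.ev_idem]
  by_cases h : O = t P
  · rw [if_pos (by rw [h, ht])]
    rw [if_pos h] at h0
    exact h01.resolve_left fun h' => one_ne_zero (h0.1 h')
  · rw [if_neg (by rintro rfl; exact h (ht O).symm)]
    rw [if_neg h] at h0
    exact h0.2 rfl

include hτ

theorem map_mem_idealOf_iff (hπ : τ π = π) (f : Q → ℕ) (x : S) :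
    τ x ∈ D.idealOf f ↔ x ∈ D.idealOf fun O => f (t O) := by
  have hdvd : ∀ k y, π ^ k ∣ τ y ↔ π ^ k ∣ y := fun k y =>
    ⟨fun h => by simpa [hτ, hπ] using map_dvd τ h, fun h => by simpa [hπ] using map_dvd τ h⟩
  have h1 : ∀ O, D.idem (t O) * τ x = τ (D.idem O * x) := fun O => by
    rw [map_mul, D.map_idem ht hev]
  simp only [mem_idealOf]
  refine ⟨fun h O => ?_, fun h O => ?_⟩
  · rw [← hdvd, ← h1]; exact h (t O)
  · have := h (t O)
    rw [← hdvd, ← h1, ht] at this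
    exact this

theorem idealOf_selfDual_iff [Fintype Q] (hπ : τ π = π) {f : Q → ℕ} (hf : ∀ O, f O ≤ r) :
    (D.idealOf f : Set S) = {v | ∀ u ∈ D.idealOf f, u * τ v = 0} ↔ ∀ O, f O + f (t O) = r := by
  have h1 : {v | ∀ u ∈ D.idealOf f, u * τ v = 0} =
      (D.idealOf fun O => r - f (t O) : Set S) := by
    ext v
    rw [Set.mem_ofPred_eq, D.forall_mul_eq_zero_iff hf, D.map_mem_idealOf_iff hτ ht hev hπ]
    rfl
  rw [h1, SetLike.coe_set_eq]
  constructor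
  · intro h O
    have := congrFun (D.idealOf_injOn hf (fun _ => Nat.sub_le _ _) h) O
    have := hf (t O)
    have := hf O
    omega
  · intro h
    congr 1
    funext O
    have := h O
    omega

theorem card_selfDual [Fintype Q] (hπ : τ π = π) :
    Nat.card {C : Ideal S // (C : Set S) = {v | ∀ u ∈ C, u * τ v = 0}} =
      Nat.card {f : Q → ℕ // ∀ O, f O + f (t O) = r} := by
  have hle : ∀ {f : Q → ℕ}, (∀ O, f O + f (t O) = r) → ∀ O, f O ≤ r := fun h O => by
    have := h O; omega
  refine (Nat.card_eq_of_bijective (fun f : {f : Q → ℕ // ∀ O, f O + f (t O) = r} =>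
    (⟨D.idealOf f.1, (D.idealOf_selfDual_iff hτ ht hev hπ (hle f.2)).2 f.2⟩ :
      {C : Ideal S // (C : Set S) = {v | ∀ u ∈ C, u * τ v = 0}})) ⟨?_, ?_⟩).symm
  · intro f g h
    exact Subtype.ext (D.idealOf_injOn (hle f.2) (hle g.2) (Subtype.ext_iff.1 h))
  · rintro ⟨C, hC⟩
    obtain ⟨f, hf, rfl⟩ := D.exists_eq_idealOf C
    exact ⟨⟨f, (D.idealOf_selfDual_iff hτ ht hev hπ hf).1 hC⟩, rfl⟩

theorem span_pow_half_selfDual [Fintype Q] (hπ : τ π = π) (hr : Even r) :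
    ((Ideal.span {π ^ (r / 2)} : Ideal S) : Set S) =
      {v | ∀ u ∈ (Ideal.span {π ^ (r / 2)} : Ideal S), u * τ v = 0} := by
  rw [← D.idealOf_const]
  obtain ⟨k, rfl⟩ := hr
  exact (D.idealOf_selfDual_iff hτ ht hev hπ (fun _ => by omega)).2 fun _ => by omega

end Involution

end ResidueSystem

/-! ### Counting exponent functions under an involution -/

theorem card_add_eq_of_odd {Q : Type*} {t : Q → Q} {r : ℕ} (hr : Odd r) {O : Q} (hO : t O = O) :
    Nat.card {f : Q → ℕ // ∀ O, f O + f (t O) = r} = 0 := by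
  have : IsEmpty {f : Q → ℕ // ∀ O, f O + f (t O) = r} := ⟨fun f => by
    have := f.2 O
    rw [hO] at this
    exact Nat.not_even_iff_odd.2 hr ⟨_, this.symm⟩⟩
  exact Nat.card_of_isEmpty

theorem card_add_eq_of_even {Q : Type*} [Fintype Q] [DecidableEq Q] {t : Q → Q}
    (ht : ∀ O, t (t O) = O) {r : ℕ} (hr : Even r) :
    ∃ e, 2 * e = (Finset.univ.filter fun O => t O ≠ O).card ∧
      Nat.card {f : Q → ℕ // ∀ O, f O + f (t O) = r} = (1 + r) ^ e := by
  -- An arbitrary order selects one point of each 2-cycle; `f` is free there, its value at the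
  -- partner is forced, and fixed points take `r / 2`.
  let _ : LinearOrder Q := LinearOrder.lift' (Fintype.equivFin Q) (Fintype.equivFin Q).injective
  let P := Finset.univ.filter fun O : Q => O < t O
  refine ⟨P.card, ?_, ?_⟩
  · have h1 : (Finset.univ.filter fun O : Q => t O < O).card = P.card := by
      refine Finset.card_nbij' t t ?_ ?_ ?_ ?_ <;> intro O <;> simp [P, ht]
    have h2 : (Finset.univ.filter fun O => t O ≠ O) =
        (Finset.univ.filter fun O : Q => t O < O) ∪ P := by
      ext O; simp [P, lt_or_lt_iff_ne]
    rw [h2, Finset.card_union_of_disjoint, h1, two_mul]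
    rw [Finset.disjoint_filter]
    intro O _ h
    exact h.asymm
  · let F : {f : Q → ℕ // ∀ O, f O + f (t O) = r} → (P → Fin (1 + r)) := fun f O =>
      ⟨f.1 O, by have := f.2 O; omega⟩
    have hF : Function.Bijective F := by
      constructor
      · intro f g h
        have h1 : ∀ O, O < t O → f.1 O = g.1 O := fun O hO => by
          have := congrFun h ⟨O, by simpa [P] using hO⟩
          simpa [F] using this
        ext O
        have hf := f.2 O
        have hg := g.2 O
        rcases lt_trichotomy O (t O) with hO | hO | hO
        · exact h1 O hO
        · rw [← hO] at hf hg; omega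
        · have := h1 (t O) (by rwa [ht])
          omega
      · intro g
        refine ⟨⟨fun O => if h : O < t O then g ⟨O, by simpa [P] using h⟩ else
          if h : t O < O then r - g ⟨t O, by simpa [P, ht] using h⟩ else r / 2, fun O => ?_⟩, ?_⟩
        · rcases lt_trichotomy O (t O) with hO | hO | hO
          · have := (g ⟨O, by simpa [P] using hO⟩).2
            simp only [ht, hO, hO.asymm, dite_true, dite_false]
            omega
          · simp only [← hO, lt_irrefl, dite_false]
            obtain ⟨k, rfl⟩ := hr
            omega
          · have := (g ⟨t O, by simpa [P, ht] using hO⟩).2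
            simp only [ht, hO, hO.asymm, dite_true, dite_false]
            omega
        · funext O
          have hO : (O : Q) < t O := (Finset.mem_filter.1 O.2).2
          apply Fin.ext
          simp [F, hO]
    rw [Nat.card_eq_of_bijective F hF, Nat.card_eq_fintype_card, Fintype.card_fun, Fintype.card_fin,
      Fintype.card_coe]

/-! ### Characters of `A` -/

/-- A perfect pairing of a finite abelian group with itself, with values in `K`. -/
structure Pairing (A K : Type*) [AddCommGroup A] [Fintype A] [DecidableEq A] [Field K] where
  /-- the pairing -/
  val : A → A → K
  add_left : ∀ a b g, val (a + b) g = val a g * val b g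
  add_right : ∀ a g h, val a (g + h) = val a g * val a h
  zero_left : ∀ g, val 0 g = 1
  zero_right : ∀ a, val a 0 = 1
  sum_right : ∀ a, ∑ g, val a g = if a = 0 then (Fintype.card A : K) else 0
  sum_left : ∀ g, ∑ a, val a g = if g = 0 then (Fintype.card A : K) else 0

theorem sum_eq_zero_of_ne_one {A K : Type*} [AddCommGroup A] [Fintype A] [Field K] {f : A → K}
    (hf : ∀ a b, f (a + b) = f a * f b) {h : A} (hh : f h ≠ 1) : ∑ g, f g = 0 := by
  have h1 : f h * ∑ g, f g = ∑ g, f g := by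
    rw [Finset.mul_sum, ← Equiv.sum_comp (Equiv.addLeft h) f]
    exact Finset.sum_congr rfl fun g _ => (hf h g).symm
  by_contra hne
  exact hh (mul_right_cancel₀ hne (by rw [h1, one_mul]))

/-- A non-canonical isomorphism of `A` with its character group lets elements of `A` index
characters, so that Frobenius on values becomes multiplication by `q` on `A`. -/
theorem exists_pairing (A K : Type*) [AddCommGroup A] [Fintype A] [DecidableEq A] [Field K]
    [IsAlgClosed K] (hA : (Fintype.card A : K) ≠ 0) : Nonempty (Pairing A K) := by
  have : NeZero ((Monoid.exponent (Multiplicative A) : ℕ) : K) := ⟨fun h => hA (by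
    obtain ⟨c, hc⟩ := Group.exponent_dvd_card (G := Multiplicative A)
    rw [Fintype.card_multiplicative] at hc
    rw [hc, Nat.cast_mul, h, zero_mul])⟩
  obtain ⟨E⟩ := CommGroup.monoidHom_mulEquiv_of_hasEnoughRootsOfUnity (Multiplicative A) K
  let v : A → A → K := fun a g => (E.symm (.ofAdd a) (.ofAdd g) : Kˣ)
  have hl : ∀ a b g, v (a + b) g = v a g * v b g := fun a b g => by simp [v]
  have hr : ∀ a g h, v a (g + h) = v a g * v a h := fun a g h => by simp [v]
  have zl : ∀ g, v 0 g = 1 := fun g => by simp [v]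
  have zr : ∀ a, v a 0 = 1 := fun a => by simp [v]
  refine ⟨v, hl, hr, zl, zr, fun a => ?_, fun g => ?_⟩
  · split_ifs with h
    · subst h; simp [zl]
    · obtain ⟨g, hg⟩ : ∃ g, v a g ≠ 1 := by
        by_contra! hcon
        refine h (E.symm.injective (a₁ := .ofAdd a) (a₂ := .ofAdd 0) ?_)
        ext g
        simpa [v] using hcon g
      exact sum_eq_zero_of_ne_one (hr a) hg
  · split_ifs with h
    · subst h; simp [zr]
    · obtain ⟨φ, hφ⟩ := CommGroup.exists_apply_ne_one_of_hasEnoughRootsOfUnity (Multiplicative A) K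
        (a := .ofAdd g) h
      exact sum_eq_zero_of_ne_one (f := fun a => v a g) (fun a b => hl a b g)
        (h := (E φ).toAdd) (by simpa [v] using hφ)

namespace Pairing

variable {A K : Type*} [AddCommGroup A] [Fintype A] [DecidableEq A] [Field K] (χ : Pairing A K)

theorem nsmul_left (n : ℕ) (a g : A) : χ.val (n • a) g = χ.val a g ^ n := by
  induction n with
  | zero => simp [χ.zero_left]
  | succ n ih => rw [succ_nsmul, χ.add_left, ih, pow_succ]

theorem neg_mul_neg (a g : A) : χ.val (-a) (-g) = χ.val a g := by
  have h1 : χ.val (-a) (-g) * χ.val (-a) g = 1 := by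
    rw [← χ.add_right, neg_add_cancel, χ.zero_right]
  have h2 : χ.val a g * χ.val (-a) g = 1 := by
    rw [← χ.add_left, add_neg_cancel, χ.zero_left]
  exact mul_right_cancel₀ (right_ne_zero_of_mul_eq_one h1) (h1.trans h2.symm)

theorem sum_mul_neg_right (a b : A) :
    ∑ g, χ.val b (-g) * χ.val a g = if a = b then (Fintype.card A : K) else 0 := by
  have : ∀ g, χ.val b (-g) * χ.val a g = χ.val (a - b) g := fun g => by
    rw [← χ.neg_mul_neg b, neg_neg, ← χ.add_left, sub_eq_neg_add]
  simp_rw [this, χ.sum_right, sub_eq_zero]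

theorem sum_mul_neg_left (g h : A) :
    ∑ a, χ.val a g * χ.val a (-h) = if g = h then (Fintype.card A : K) else 0 := by
  simp_rw [← χ.add_right, χ.sum_left, add_neg_eq_zero]

end Pairing

/-! ### Reduction modulo `p` and Fourier analysis on `R[A]` -/

/-- A ring hom from `R` onto the field with `q` elements inside `K`, where `p` generates the kernel
and is nilpotent of exact order `r`. -/
structure ResidueMap (p r q : ℕ) (R K : Type*) [CommRing R] [Field K] where
  /-- the reduction -/
  φ : R →+* K
  map_eq_zero_iff : ∀ x, φ x = 0 ↔ (p : R) ∣ x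
  pow_map : ∀ x, φ x ^ q = φ x
  exists_of_pow_eq : ∀ c, c ^ q = c → ∃ x, φ x = c
  pow_eq_zero : (p : R) ^ r = 0
  dvd_of_pow_mul : ∀ i ≤ r, ∀ x, (p : R) ^ i * x = 0 → (p : R) ^ (r - i) ∣ x

theorem coeff_natCast_mul {R A : Type*} [CommRing R] [AddCommGroup A] (n : ℕ)
    (x : AddMonoidAlgebra R A) (g : A) : ((n : AddMonoidAlgebra R A) * x).coeff g =
      n * x.coeff g := by
  rw [← nsmul_eq_mul, AddMonoidAlgebra.coeff_smul, Finsupp.smul_apply, nsmul_eq_mul]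

theorem natCast_dvd_iff {R A : Type*} [CommRing R] [AddCommGroup A] [Fintype A] (n : ℕ)
    (x : AddMonoidAlgebra R A) :
    (n : AddMonoidAlgebra R A) ∣ x ↔ ∀ g, (n : R) ∣ x.coeff g := by
  refine ⟨?_, fun h => ?_⟩
  · rintro ⟨y, rfl⟩ g
    exact ⟨y.coeff g, coeff_natCast_mul n y g⟩
  · choose y hy using h
    refine ⟨.ofCoeff (Finsupp.equivFunOnFinite.symm y), ?_⟩
    ext g
    rw [coeff_natCast_mul, hy]
    rfl

theorem sum_single_coeff {R A : Type*} [CommRing R] [Fintype A] (x : AddMonoidAlgebra R A) :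
    ∑ g, AddMonoidAlgebra.single g (x.coeff g) = x := by
  ext h
  simp [AddMonoidAlgebra.coeff_sum]

theorem nsmul_bijective {A : Type*} [AddCommGroup A] [Fintype A] {n : ℕ} (h : n.Coprime (Fintype.card A)) :
    Function.Bijective fun a : A => n • a := by
  rw [← Nat.card_eq_fintype_card] at h
  exact (nsmulCoprime h.symm).bijective

namespace ResidueMap

section

variable {p r q : ℕ} {R K A : Type*} [CommRing R] [Field K] [AddCommGroup A] [Fintype A]
  [DecidableEq A] (F : ResidueMap p r q R K) (χ : Pairing A K)

/-- The evaluation of `R[A]` at a character. -/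
noncomputable def eval (a : A) : AddMonoidAlgebra R A →+* K :=
  AddMonoidAlgebra.liftNCRingHom F.φ
    { toFun := fun g => χ.val a g.toAdd
      map_one' := χ.zero_right a
      map_mul' := fun g h => χ.add_right a g.toAdd h.toAdd } fun _ _ => .all _ _

theorem eval_single (a g : A) (c : R) :
    F.eval χ a (.single g c) = F.φ c * χ.val a g :=
  AddMonoidAlgebra.liftNCRingHom_single ..

theorem eval_eq_sum (a : A) (x : AddMonoidAlgebra R A) :
    F.eval χ a x = ∑ g, F.φ (x.coeff g) * χ.val a g := by
  conv_lhs => rw [← sum_single_coeff x]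
  rw [map_sum]
  exact Finset.sum_congr rfl fun g _ => F.eval_single χ a g _

/-- Fourier inversion, with the factor `|A|` left in place. -/
theorem sum_eval_mul (x : AddMonoidAlgebra R A) (h : A) :
    ∑ a, F.eval χ a x * χ.val a (-h) = Fintype.card A * F.φ (x.coeff h) := by
  simp_rw [F.eval_eq_sum, Finset.sum_mul, mul_assoc]
  rw [Finset.sum_comm]
  simp_rw [← Finset.mul_sum, χ.sum_mul_neg_left]
  simp [mul_comm]

theorem dvd_of_eval_eq_zero (hA : (Fintype.card A : K) ≠ 0) {x : AddMonoidAlgebra R A}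
    (h : ∀ a, F.eval χ a x = 0) : (p : AddMonoidAlgebra R A) ∣ x := by
  rw [natCast_dvd_iff]
  intro g
  rw [← F.map_eq_zero_iff]
  have := F.sum_eval_mul χ x g
  simp only [h, zero_mul, Finset.sum_const_zero] at this
  exact (mul_eq_zero.1 this.symm).resolve_left hA

end

variable {p r s : ℕ} {R K A : Type*} [Fact p.Prime] [CommRing R] [Field K] [CharP K p]
  [AddCommGroup A] [Fintype A] [DecidableEq A] (F : ResidueMap p r (p ^ s) R K) (χ : Pairing A K)

theorem eval_nsmul (a : A) (x : AddMonoidAlgebra R A) :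
    F.eval χ ((p ^ s) • a) x = F.eval χ a x ^ (p ^ s) := by
  rw [F.eval_eq_sum, F.eval_eq_sum, sum_pow_char_pow]
  refine Finset.sum_congr rfl fun g _ => ?_
  rw [mul_pow, F.pow_map, χ.nsmul_left]

theorem eval_pow_nsmul (i : ℕ) (a : A) (x : AddMonoidAlgebra R A) :
    F.eval χ ((p ^ s) ^ i • a) x = F.eval χ a x ^ (p ^ s) ^ i := by
  induction i with
  | zero => simp
  | succ i ih => rw [pow_succ (p ^ s) i, pow_mul, ← ih, ← F.eval_nsmul, mul_nsmul]

/-- Frobenius-equivariance of `c` makes its inverse Fourier coefficients fixed by the `q`-power map,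
so they lie in the residue field and lift to `R`. -/
theorem exists_eval_eq (hA : (Fintype.card A : K) ≠ 0) (hpA : p.Coprime (Fintype.card A))
    {c : A → K} (hc : ∀ a, c (p ^ s • a) = c a ^ p ^ s) :
    ∃ z : AddMonoidAlgebra R A, ∀ a, F.eval χ a z = c a := by
  have hz : ∀ g, ∃ y, F.φ y = (Fintype.card A : K)⁻¹ * ∑ b, c b * χ.val b (-g) := fun g => by
    refine F.exists_of_pow_eq _ ?_
    rw [mul_pow, inv_pow, sum_pow_char_pow]
    congr 1
    · rw [← iterateFrobenius_def, map_natCast]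
    · rw [← (nsmul_bijective (hpA.pow_left s)).sum_comp fun b => c b * χ.val b (-g)]
      refine Finset.sum_congr rfl fun b _ => ?_
      rw [mul_pow, hc, χ.nsmul_left]
  choose y hy using hz
  refine ⟨.ofCoeff (Finsupp.equivFunOnFinite.symm y), fun a => ?_⟩
  rw [F.eval_eq_sum]
  simp only [Finsupp.equivFunOnFinite_symm_apply_apply, hy]
  simp_rw [mul_assoc, ← Finset.mul_sum, Finset.sum_mul]
  rw [Finset.sum_comm]
  simp_rw [mul_assoc, ← Finset.mul_sum, χ.sum_mul_neg_right]
  simp [hA, mul_comm]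

end ResidueMap

/-! ### Cyclotomic classes and the components of `R[A]` -/

/-- Two elements are related if one is a `q`-power multiple of the other. -/
def cyclotomicSetoid (A : Type*) [AddCommGroup A] [Fintype A] (q : ℕ)
    (hq : q.Coprime (Fintype.card A)) : Setoid A where
  r a b := ∃ i : ℕ, q ^ i • a = b
  iseqv := by
    -- Symmetry: by Euler, `q ^ φ(|A|)` acts trivially on `A`, so the inverse of `q ^ i` is again a
    -- power of `q`.
    have hpos : 0 < (Fintype.card A).totient := Nat.totient_pos.2 Fintype.card_pos
    have h1 : ∀ (i : ℕ) (a : A), q ^ ((Fintype.card A).totient * i) • a = a := fun i a => by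
      have hm : q ^ ((Fintype.card A).totient * i) ≡ 1 [MOD addOrderOf a] := by
        refine Nat.ModEq.of_dvd (addOrderOf_dvd_card (x := a)) ?_
        rw [pow_mul]
        simpa using (Nat.ModEq.pow_totient hq).pow i
      have := (nsmul_eq_nsmul_iff_modEq (x := a)).2 hm
      rwa [one_nsmul] at this
    refine ⟨fun a => ⟨0, by simp⟩, ?_, ?_⟩
    · rintro a _ ⟨i, rfl⟩
      refine ⟨(Fintype.card A).totient * i - i, ?_⟩
      rw [← mul_nsmul', ← pow_add, Nat.sub_add_cancel (Nat.le_mul_of_pos_left i hpos), h1]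
    · rintro a _ _ ⟨i, rfl⟩ ⟨j, rfl⟩
      exact ⟨j + i, by rw [pow_add, mul_nsmul']⟩

/-- The `q`-cyclotomic classes of `A`. -/
abbrev CyclotomicClass (A : Type*) [AddCommGroup A] [Fintype A] (q : ℕ)
    (hq : q.Coprime (Fintype.card A)) : Type _ := Quotient (cyclotomicSetoid A q hq)

noncomputable instance (A : Type*) [AddCommGroup A] [Fintype A] (q : ℕ)
    (hq : q.Coprime (Fintype.card A)) : Fintype (CyclotomicClass A q hq) :=
  @Quotient.fintype A _ _ (Classical.decRel _)

namespace ResidueMap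

variable {p r s : ℕ} {R K A : Type*} [Fact p.Prime] [CommRing R] [Field K] [CharP K p]
  [AddCommGroup A] [Fintype A] [DecidableEq A] (F : ResidueMap p r (p ^ s) R K) (χ : Pairing A K)
  (hq : (p ^ s).Coprime (Fintype.card A))

theorem eval_eq_zero_iff_of_rel {a b : A}
    (h : (⟦a⟧ : CyclotomicClass A (p ^ s) hq) = ⟦b⟧) (x : AddMonoidAlgebra R A) :
    F.eval χ a x = 0 ↔ F.eval χ b x = 0 := by
  obtain ⟨i, rfl⟩ := Quotient.exact h
  rw [F.eval_pow_nsmul, pow_eq_zero_iff (by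
    have := (Fact.out : p.Prime).pos
    positivity)]

open Classical in
/-- The residue system of `R[A]` given by one character in each cyclotomic class. -/
noncomputable def residueSystem (hA : (Fintype.card A : K) ≠ 0)
    (hpA : p.Coprime (Fintype.card A)) :
    ResidueSystem (p : AddMonoidAlgebra R A) r (CyclotomicClass A (p ^ s) hq) K where
  ev O := F.eval χ O.out
  ev_self O := by rw [map_natCast, CharP.cast_eq_zero]
  dvd_of_ev x h := F.dvd_of_eval_eq_zero χ hA fun a => by
    rw [F.eval_eq_zero_iff_of_rel χ hq (Quotient.out_eq ⟦a⟧).symm]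
    exact h _
  pow_eq_zero := by
    rw [← Nat.cast_pow, AddMonoidAlgebra.natCast_def, Nat.cast_pow, F.pow_eq_zero,
      AddMonoidAlgebra.single_zero]
  dvd_of_pow_mul i hi x h := by
    rw [← Nat.cast_pow, natCast_dvd_iff]
    intro g
    rw [Nat.cast_pow]
    refine F.dvd_of_pow_mul i hi _ ?_
    rw [← Nat.cast_pow, ← coeff_natCast_mul, Nat.cast_pow, h]
    rfl
  exists_mul O x hx := by
    -- The prescribed values are supported on one class; they are equivariant because the class is
    -- stable under `p ^ s`.
    obtain ⟨z, hz⟩ := F.exists_eval_eq χ hA hpA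
      (c := fun a => if (⟦a⟧ : CyclotomicClass A (p ^ s) hq) = O then (F.eval χ a x)⁻¹ else 0)
      (fun a => by
        have h : (⟦p ^ s • a⟧ : CyclotomicClass A (p ^ s) hq) = ⟦a⟧ :=
          Eq.symm (Quotient.sound ⟨1, by rw [pow_one]⟩)
        have : p ^ s ≠ 0 := (pow_pos (Fact.out : p.Prime).pos s).ne'
        simp only [h, F.eval_nsmul]
        split_ifs
        · rw [inv_pow]
        · rw [zero_pow this])
    refine ⟨z, fun O' => ?_⟩
    rw [map_mul, hz, Quotient.out_eq]
    by_cases h : O' = O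
    · subst h
      simp [hx]
    · rw [if_neg h, if_neg (Ne.symm h), zero_mul]

end ResidueMap

/-! ### Duals as annihilators, and the count in terms of classes -/

/-- The semilinear map `∑ c_g g ↦ ∑ σ(c_g) (-g)` on `R[A]`. -/
noncomputable def semilinearInvolution {R A : Type*} [CommRing R] [AddCommGroup A] (σ : R →+* R) :
    AddMonoidAlgebra R A →+* AddMonoidAlgebra R A :=
  (AddMonoidAlgebra.mapRingHom A σ).comp
    (AddMonoidAlgebra.mapDomainRingEquiv R (AddEquiv.neg A)).toRingHom

section Involution

variable {R A : Type*} [CommRing R] [AddCommGroup A] (σ : R →+* R)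

theorem coeff_semilinearInvolution (x : AddMonoidAlgebra R A) (g : A) :
    (semilinearInvolution σ x).coeff g = σ (x.coeff (-g)) := by
  simp [semilinearInvolution]

theorem semilinearInvolution_involutive (hσ : ∀ c, σ (σ c) = c) (x : AddMonoidAlgebra R A) :
    semilinearInvolution σ (semilinearInvolution σ x) = x := by
  ext g
  simp [coeff_semilinearInvolution, hσ]

/-- Each coefficient of `u * τ v` is the form evaluated at a translate of `u` and at `v`; an ideal
contains all translates of its elements. -/
theorem dual_eq [Fintype A] (C : Ideal (AddMonoidAlgebra R A)) :
    {v : AddMonoidAlgebra R A | ∀ u ∈ C, ∑ g, u.coeff g * σ (v.coeff g) = 0} =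
      {v | ∀ u ∈ C, u * semilinearInvolution σ v = 0} := by
  have h : ∀ u v : AddMonoidAlgebra R A, ∀ h : A, (u * semilinearInvolution σ v).coeff h =
      ∑ g, (AddMonoidAlgebra.single (-h) 1 * u).coeff g * σ (v.coeff g) := fun u v h => by
    rw [AddMonoidAlgebra.coeff_mul_apply_left, Finsupp.sum_fintype _ _ (by simp),
      ← Equiv.sum_comp (Equiv.addLeft h)]
    refine Finset.sum_congr rfl fun g _ => ?_
    simp [coeff_semilinearInvolution, AddMonoidAlgebra.coeff_single_mul_apply]
  ext v
  refine ⟨fun hv u hu => ?_, fun hv u hu => ?_⟩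
  · ext k
    rw [h, hv _ (C.mul_mem_left _ hu)]
    rfl
  · have := h u v 0
    rw [hv u hu, neg_zero, ← AddMonoidAlgebra.one_def, one_mul] at this
    exact this.symm

end Involution

/-- The map induced on cyclotomic classes by multiplication by `-n`. -/
def CyclotomicClass.negMul {A : Type*} [AddCommGroup A] [Fintype A] {q : ℕ}
    (hq : q.Coprime (Fintype.card A)) (n : ℕ) : CyclotomicClass A q hq → CyclotomicClass A q hq :=
  Quotient.map (fun a => -(n • a)) (by
    rintro a _ ⟨i, rfl⟩
    exact ⟨i, by rw [smul_neg, smul_comm]⟩)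

section Count

variable {p r s h : ℕ} {R K A : Type*} [Fact p.Prime] [CommRing R] [Field K] [CharP K p]
  [AddCommGroup A] [Fintype A] [DecidableEq A]

theorem ResidueMap.eval_semilinearInvolution {q : ℕ} (F : ResidueMap p r q R K) (χ : Pairing A K)
    {σ : R →+* R} (hF : ∀ c, F.φ (σ c) = F.φ c ^ p ^ h) (a : A) (x : AddMonoidAlgebra R A) :
    F.eval χ (-(p ^ h • a)) (semilinearInvolution σ x) = F.eval χ a x ^ p ^ h := by
  rw [F.eval_eq_sum, F.eval_eq_sum, sum_pow_char_pow, ← Equiv.sum_comp (Equiv.neg A)]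
  refine Finset.sum_congr rfl fun g _ => ?_
  rw [coeff_semilinearInvolution, Equiv.neg_apply, neg_neg, hF, χ.neg_mul_neg, mul_pow,
    χ.nsmul_left]

open Classical in
-- Treats both forms at once. The hypothesis `hh` makes `a ↦ -(p ^ h • a)` an involution on classes.
theorem card_selfDual_of_semilinear [IsAlgClosed K] (hpA : p.Coprime (Fintype.card A))
    (hq : (p ^ s).Coprime (Fintype.card A)) (F : ResidueMap p r (p ^ s) R K)
    {σ : R →+* R} (hσ : ∀ c, σ (σ c) = c) (hF : ∀ c, F.φ (σ c) = F.φ c ^ p ^ h)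
    (hh : ∃ k, p ^ h * p ^ h = (p ^ s) ^ k) :
    (Odd r → Nat.card {C : Ideal (AddMonoidAlgebra R A) // (C : Set (AddMonoidAlgebra R A)) =
      {v | ∀ u ∈ C, ∑ g, u.coeff g * σ (v.coeff g) = 0}} = 0) ∧
    (Even r → ∃ e, 2 * e = (Finset.univ.filter fun O : CyclotomicClass A (p ^ s) hq =>
        CyclotomicClass.negMul hq (p ^ h) O ≠ O).card ∧
      Nat.card {C : Ideal (AddMonoidAlgebra R A) // (C : Set (AddMonoidAlgebra R A)) =
        {v | ∀ u ∈ C, ∑ g, u.coeff g * σ (v.coeff g) = 0}} = (1 + r) ^ e) ∧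
    (Even r → (trivialCode R A p r : Set (AddMonoidAlgebra R A)) =
      {v | ∀ u ∈ trivialCode R A p r, ∑ g, u.coeff g * σ (v.coeff g) = 0}) := by
  have hA : (Fintype.card A : K) ≠ 0 := by
    rw [Ne, CharP.cast_eq_zero_iff K p]
    exact fun hd => (Fact.out : p.Prime).one_lt.ne' (hpA.eq_one_of_dvd hd)
  obtain ⟨χ⟩ := exists_pairing A K hA
  set t := CyclotomicClass.negMul (A := A) hq (p ^ h) with ht_def
  have ht : ∀ O, t (t O) = O := by
    rintro ⟨a⟩
    obtain ⟨k, hk⟩ := hh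
    refine Eq.symm (Quotient.sound ⟨k, ?_⟩)
    dsimp only
    rw [← hk, smul_neg, neg_neg, mul_nsmul]
  have hev : ∀ O x, (F.residueSystem χ hq hA hpA).ev (t O) (semilinearInvolution σ x) = 0 ↔
      (F.residueSystem χ hq hA hpA).ev O x = 0 := by
    intro O x
    have h1 : (⟦(t O).out⟧ : CyclotomicClass A (p ^ s) hq) = ⟦-(p ^ h • O.out)⟧ := by
      rw [Quotient.out_eq]
      conv_lhs => rw [← Quotient.out_eq O]
      rfl
    change F.eval χ (t O).out (semilinearInvolution σ x) = 0 ↔ F.eval χ O.out x = 0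
    rw [F.eval_eq_zero_iff_of_rel χ hq h1, F.eval_semilinearInvolution χ hF,
      pow_eq_zero_iff (pow_pos (Fact.out : p.Prime).pos h).ne']
  have hτ := semilinearInvolution_involutive (A := A) σ hσ
  have hπ : semilinearInvolution (A := A) σ (p : AddMonoidAlgebra R A) = p := map_natCast _ _
  have hcard := (F.residueSystem χ hq hA hpA).card_selfDual hτ ht hev hπ
  simp only [dual_eq]
  rw [hcard]
  refine ⟨fun hr => ?_, fun hr => card_add_eq_of_even ht hr, fun hr => ?_⟩
  · refine card_add_eq_of_odd hr (O := ⟦0⟧) (Quotient.sound ⟨0, ?_⟩)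
    simp
  · exact (F.residueSystem χ hq hA hpA).span_pow_half_selfDual hτ ht hev hπ hr

end Count

/-! ### Sizes of classes, and goodness as fixedness -/

section Orbits

variable {A : Type*} [AddCommGroup A] [Fintype A] {q : ℕ} (hq : q.Coprime (Fintype.card A))

theorem pow_nsmul_eq_iff {A : Type*} [AddCommGroup A] (q : ℕ) (a : A) (i j : ℕ) :
    q ^ i • a = q ^ j • a ↔ (q : ZMod (addOrderOf a)) ^ i = (q : ZMod (addOrderOf a)) ^ j := by
  rw [nsmul_eq_nsmul_iff_modEq, ← ZMod.natCast_eq_natCast_iff, Nat.cast_pow, Nat.cast_pow]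

theorem ordMod_pos {d : ℕ} (hd : 0 < d) (hq : q.Coprime d) : 0 < ordMod d q := by
  rw [ordMod, orderOf_pos_iff, isOfFinOrder_iff_pow_eq_one]
  refine ⟨d.totient, Nat.totient_pos.2 hd, ?_⟩
  rw [← Nat.cast_pow, ← Nat.cast_one, ZMod.natCast_eq_natCast_iff]
  exact Nat.ModEq.pow_totient hq

include hq in
theorem ordMod_addOrderOf_pos (a : A) : 0 < ordMod (addOrderOf a) q :=
  ordMod_pos (addOrderOf_pos a) (hq.coprime_dvd_right addOrderOf_dvd_card)

open Classical in
theorem card_cyclotomicClass (a : A) :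
    (Finset.univ.filter fun b : A => (⟦b⟧ : CyclotomicClass A q hq) = ⟦a⟧).card =
      ordMod (addOrderOf a) q := by
  have h1 : (Finset.univ.filter fun b : A => (⟦b⟧ : CyclotomicClass A q hq) = ⟦a⟧) =
      (Finset.range (ordMod (addOrderOf a) q)).image fun i => q ^ i • a := by
    ext b
    simp only [Finset.mem_filter, Finset.mem_univ, true_and, Finset.mem_image, Finset.mem_range]
    constructor
    · intro h
      obtain ⟨i, rfl⟩ := Quotient.exact h.symm
      exact ⟨i % ordMod (addOrderOf a) q, Nat.mod_lt _ (ordMod_addOrderOf_pos hq a),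
        (pow_nsmul_eq_iff q a _ _).2 (pow_mod_orderOf _ _)⟩
    · rintro ⟨i, -, rfl⟩
      exact Eq.symm (Quotient.sound ⟨i, rfl⟩)
  rw [h1, Finset.card_image_of_injOn, Finset.card_range]
  intro i hi j hj hij
  refine pow_injOn_Iio_orderOf ?_ ?_ ((pow_nsmul_eq_iff q a i j).1 hij)
  · simpa [ordMod] using hi
  · simpa [ordMod] using hj

open Classical in
theorem card_filter_cyclotomicClass {b : ℕ → Prop} {P : CyclotomicClass A q hq → Prop}
    [DecidablePred P]
    (hP : ∀ a, P ⟦a⟧ ↔ b (addOrderOf a)) :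
    ((Finset.univ.filter P).card : ℚ) = ∑ d ∈ (AddMonoid.exponent A).divisors,
      (if b d then 1 else 0 : ℚ) * ((numOfOrder A d : ℚ) / (ordMod d q : ℚ)) := by
  -- Each element is weighted by the inverse size of its class, so a class satisfying `P` has total
  -- weight 1; the sum is then regrouped by order.
  let w : ℕ → ℚ := fun d => (if b d then 1 else 0) / (ordMod d q : ℚ)
  have h1 : ((Finset.univ.filter P).card : ℚ) = ∑ a : A, w (addOrderOf a) := by
    rw [← Finset.sum_fiberwise Finset.univ (fun a : A => (⟦a⟧ : CyclotomicClass A q hq)),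
      Finset.card_filter, Nat.cast_sum]
    refine Finset.sum_congr rfl ?_
    rintro ⟨a⟩ -
    have hfib : ∀ a' ∈ (Finset.univ.filter fun a' : A =>
        (⟦a'⟧ : CyclotomicClass A q hq) = ⟦a⟧), w (addOrderOf a') = w (addOrderOf a) := by
      intro a' ha'
      have h2 := (Finset.mem_filter.1 ha').2
      have h3 : b (addOrderOf a') ↔ b (addOrderOf a) := by rw [← hP, ← hP, h2]
      simp only [w, h3, ← card_cyclotomicClass hq, h2]
    change ((if P (Quotient.mk _ a) then 1 else 0 : ℕ) : ℚ) = _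
    refine Eq.trans ?_ (Finset.sum_congr rfl hfib).symm
    rw [Finset.sum_const, card_cyclotomicClass, nsmul_eq_mul]
    have := (ordMod_addOrderOf_pos hq a).ne'
    simp only [w, hP]
    split_ifs <;> simp [this]
  rw [h1, ← Finset.sum_fiberwise_of_maps_to (s := Finset.univ)
    (t := (AddMonoid.exponent A).divisors) (g := fun a : A => addOrderOf a) (fun a _ => by
      rw [Nat.mem_divisors]
      exact ⟨AddMonoid.addOrder_dvd_exponent a, AddMonoid.exponent_ne_zero_of_finite⟩)]
  refine Finset.sum_congr rfl fun d _ => ?_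
  rw [Finset.sum_congr rfl (g := fun _ => w d) fun a ha => by rw [(Finset.mem_filter.1 ha).2],
    Finset.sum_const, numOfOrder, Nat.card_eq_fintype_card, Fintype.card_subtype, nsmul_eq_mul]
  simp only [w]
  ring

theorem negMul_mk_eq_iff (n : ℕ) (a : A) :
    CyclotomicClass.negMul hq n ⟦a⟧ = ⟦a⟧ ↔ ∃ i, addOrderOf a ∣ q ^ i + n := by
  have h1 : ∀ i, addOrderOf a ∣ q ^ i + n ↔ q ^ i • a = -(n • a) := fun i => by
    rw [addOrderOf_dvd_iff_nsmul_eq_zero, add_nsmul, eq_neg_iff_add_eq_zero]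
  simp only [h1]
  refine ⟨fun h => ?_, fun ⟨i, hi⟩ => ?_⟩
  · exact Quotient.exact h.symm
  · exact Eq.symm (Quotient.sound ⟨i, hi⟩)

/-- Adding the period `ord_d(q)` makes the exponent positive, as the definitions of goodness demand.
-/
theorem exists_dvd_pow_add_iff {d n : ℕ} (hd : 0 < d) (hq : q.Coprime d) :
    (∃ i, d ∣ q ^ i + n) ↔ ∃ i, 1 ≤ i ∧ d ∣ q ^ i + n := by
  refine ⟨fun ⟨i, hi⟩ => ⟨i + ordMod d q, by have := ordMod_pos hd hq; omega, ?_⟩,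
    fun ⟨i, _, hi⟩ => ⟨i, hi⟩⟩
  rw [← ZMod.natCast_eq_zero_iff] at hi ⊢
  rw [← hi]
  push_cast
  rw [pow_add, ordMod, pow_orderOf_eq_one, mul_one]

theorem good_iff {d : ℕ} (hd : 0 < d) (hq : q.Coprime d) : Good d q ↔ ∃ i, d ∣ q ^ i + 1 := by
  rw [exists_dvd_pow_add_iff hd hq]
  constructor
  · rintro (⟨t, h1, _, h⟩ | ⟨t, h1, _, h⟩)
    · exact ⟨t, h1, h⟩
    · exact ⟨t, by omega, h⟩
  · rintro ⟨t, h1, h⟩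
    rcases Nat.even_or_odd t with ht | ht
    · exact Or.inr ⟨t, by obtain ⟨k, rfl⟩ := ht; omega, ht, h⟩
    · exact Or.inl ⟨t, h1, ht, h⟩

/-- Multiply `n ^ (2k+1) + 1` by `n`, which is invertible modulo `d`. -/
theorem oddlyGood_iff {d n : ℕ} (hd : 0 < d) (hn : n.Coprime d) :
    OddlyGood d n ↔ ∃ i, d ∣ (n ^ 2) ^ i + n := by
  rw [exists_dvd_pow_add_iff hd (hn.pow_left 2)]
  constructor
  · rintro ⟨_, -, ⟨k, rfl⟩, h⟩
    refine ⟨k + 1, by omega, ?_⟩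
    have : (n ^ 2) ^ (k + 1) + n = n * (n ^ (2 * k + 1) + 1) := by ring
    rw [this]
    exact h.mul_left _
  · rintro ⟨i, hi, h⟩
    obtain ⟨k, rfl⟩ := Nat.exists_eq_add_of_le' hi
    refine ⟨2 * k + 1, by omega, ⟨k, rfl⟩, ?_⟩
    have : (n ^ 2) ^ (k + 1) + n = n * (n ^ (2 * k + 1) + 1) := by ring
    rw [this] at h
    exact hn.symm.dvd_of_dvd_mul_left h

end Orbits

/-! ### The residue field of `(ℤ/p^r)[X]/(f)` -/

section AdjoinRoot

theorem castHom_eq_zero_iff {p r : ℕ} (hp : 0 < p) (h : p ∣ p ^ r) (b : ZMod (p ^ r)) :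
    ZMod.castHom h (ZMod p) b = 0 ↔ (p : ZMod (p ^ r)) ∣ b := by
  have : NeZero (p ^ r) := ⟨(pow_pos hp r).ne'⟩
  refine ⟨fun hb => ?_, ?_⟩
  · rw [← ZMod.natCast_zmod_val b] at hb ⊢
    rw [map_natCast, ZMod.natCast_eq_zero_iff] at hb
    exact Nat.cast_dvd_cast hb
  · rintro ⟨y, rfl⟩
    rw [map_mul, map_natCast, ZMod.natCast_self, zero_mul]

theorem zmod_dvd_of_pow_mul_eq_zero {p r i : ℕ} (hp : 0 < p) (hi : i ≤ r) {b : ZMod (p ^ r)}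
    (hb : (p : ZMod (p ^ r)) ^ i * b = 0) : (p : ZMod (p ^ r)) ^ (r - i) ∣ b := by
  have : NeZero (p ^ r) := ⟨(pow_pos hp r).ne'⟩
  rw [← ZMod.natCast_zmod_val b] at hb ⊢
  rw [← Nat.cast_pow, ← Nat.cast_mul, ZMod.natCast_eq_zero_iff] at hb
  rw [← Nat.cast_pow]
  refine Nat.cast_dvd_cast (Nat.dvd_of_mul_dvd_mul_left (pow_pos hp i) ?_)
  rwa [← pow_add, Nat.add_sub_cancel' hi]

variable {p r : ℕ} [Fact p.Prime] {h : p ∣ p ^ r} {f : (ZMod (p ^ r))[X]} (hf : f.Monic)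
  (hirr : Irreducible (f.map (ZMod.castHom h (ZMod p)))) {K : Type*} [Field K] [Algebra (ZMod p) K]
  {θ : K} (hθ : f.eval₂ ((algebraMap (ZMod p) K).comp (ZMod.castHom h (ZMod p))) θ = 0)

include hf hirr hθ

theorem lift_eq_zero_iff (x : AdjoinRoot f) :
    AdjoinRoot.lift ((algebraMap (ZMod p) K).comp (ZMod.castHom h (ZMod p))) θ hθ x = 0 ↔
      (p : AdjoinRoot f) ∣ x := by
  have hp := (Fact.out : p.Prime)
  obtain ⟨g, rfl⟩ := AdjoinRoot.mk_surjective x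
  rw [AdjoinRoot.lift_mk]
  constructor
  · intro hg
    -- The reduction of `f` is the minimal polynomial of `θ`, so `g` is a multiple of `f` up to
    -- coefficients divisible by `p`.
    have hmin : f.map (ZMod.castHom h (ZMod p)) = minpoly (ZMod p) θ :=
      minpoly.eq_of_irreducible_of_monic hirr (by rw [aeval_def, eval₂_map, hθ]) (hf.map _)
    obtain ⟨k, hk⟩ : f.map (ZMod.castHom h (ZMod p)) ∣ g.map (ZMod.castHom h (ZMod p)) := by
      rw [hmin]
      refine minpoly.dvd _ _ ?_
      rw [aeval_def, eval₂_map, hg]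
    obtain ⟨k, rfl⟩ := map_surjective _ (ZMod.ringHom_surjective (ZMod.castHom h (ZMod p))) k
    obtain ⟨w, hw⟩ : C (p : ZMod (p ^ r)) ∣ g - f * k := by
      rw [C_dvd_iff_dvd_coeff]
      intro n
      rw [← castHom_eq_zero_iff hp.pos h, ← coeff_map, Polynomial.map_sub, Polynomial.map_mul, hk,
        sub_self, coeff_zero]
    refine ⟨AdjoinRoot.mk f w, ?_⟩
    rw [eq_add_of_sub_eq hw, map_add, map_mul, map_mul, AdjoinRoot.mk_self, zero_mul, add_zero,
      C_eq_natCast, map_natCast]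
  · rintro ⟨y, hy⟩
    rw [← AdjoinRoot.lift_mk hθ g, hy, map_mul, map_natCast,
      ← map_natCast (algebraMap (ZMod p) K), ZMod.natCast_self, map_zero, zero_mul]

theorem pow_eq_self_iff_exists_eval₂ (c : K) : c ^ p ^ f.natDegree = c ↔
    ∃ g : (ZMod (p ^ r))[X],
      g.eval₂ ((algebraMap (ZMod p) K).comp (ZMod.castHom h (ZMod p))) θ = c := by
  classical
  set f' := f.map (ZMod.castHom h (ZMod p)) with hf'
  have hmon : f'.Monic := hf.map _
  have : Fact (Irreducible f') := ⟨hirr⟩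
  have : Module.Finite (ZMod p) (AdjoinRoot f') := hmon.finite_adjoinRoot
  have : Finite (AdjoinRoot f') := Module.finite_of_finite (ZMod p)
  let _ : Fintype (AdjoinRoot f') := Fintype.ofFinite _
  have hcard : Fintype.card (AdjoinRoot f') = p ^ f.natDegree := by
    rw [← Nat.card_eq_fintype_card, Module.natCard_eq_pow_finrank (K := ZMod p), Nat.card_zmod,
      (AdjoinRoot.powerBasis' hmon).finrank, AdjoinRoot.powerBasis'_dim, hf', hf.natDegree_map]
  have hθ' : f'.eval₂ (algebraMap (ZMod p) K) θ = 0 := by rw [hf', eval₂_map, hθ]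
  let ψ : AdjoinRoot f' →+* K := AdjoinRoot.lift (algebraMap (ZMod p) K) θ hθ'
  have hψ : ∀ y, ψ y ^ p ^ f.natDegree = ψ y := fun y => by
    rw [← map_pow, ← hcard, FiniteField.pow_card]
  have hq : 1 < p ^ f.natDegree := by rw [← hcard]; exact Fintype.one_lt_card
  have hrange : ∀ c, c ^ p ^ f.natDegree = c → ∃ y, ψ y = c := by
    intro c hc
    have hne := FiniteField.X_pow_card_sub_X_ne_zero K hq
    have hsub : Finset.univ.image ψ ⊆ (X ^ p ^ f.natDegree - X : K[X]).roots.toFinset := by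
      intro z hz
      obtain ⟨y, -, rfl⟩ := Finset.mem_image.1 hz
      simp [hne, hψ]
    -- The image already has `p ^ deg f` elements, the maximal number of roots of `X ^ (p ^ deg f) -
    -- X`.
    have heq := Finset.eq_of_subset_of_card_le hsub (by
      rw [Finset.card_image_of_injective _ ψ.injective, Finset.card_univ, hcard]
      refine (Multiset.toFinset_card_le _).trans ((card_roots' _).trans ?_)
      rw [FiniteField.X_pow_card_sub_X_natDegree_eq K hq])
    have : c ∈ Finset.univ.image ψ := by
      rw [heq]
      simp [hne, hc]
    simpa using this
  constructor
  · intro hc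
    obtain ⟨y, rfl⟩ := hrange c hc
    obtain ⟨g, rfl⟩ := AdjoinRoot.mk_surjective y
    obtain ⟨g, rfl⟩ := map_surjective _ (ZMod.ringHom_surjective (ZMod.castHom h (ZMod p))) g
    exact ⟨g, by rw [AdjoinRoot.lift_mk, eval₂_map]⟩
  · rintro ⟨g, rfl⟩
    rw [← eval₂_map, ← AdjoinRoot.lift_mk hθ']
    exact hψ _

/-- The reduction of the Galois ring `(ℤ/p^r)[X]/(f)`. -/
noncomputable def residueMapAdjoinRoot :
    ResidueMap p r (p ^ f.natDegree) (AdjoinRoot f) K where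
  φ := AdjoinRoot.lift ((algebraMap (ZMod p) K).comp (ZMod.castHom h (ZMod p))) θ hθ
  map_eq_zero_iff := lift_eq_zero_iff hf hirr hθ
  pow_map x := by
    obtain ⟨g, rfl⟩ := AdjoinRoot.mk_surjective x
    rw [AdjoinRoot.lift_mk, pow_eq_self_iff_exists_eval₂ hf hirr hθ]
    exact ⟨g, rfl⟩
  exists_of_pow_eq c hc := by
    obtain ⟨g, hg⟩ := (pow_eq_self_iff_exists_eval₂ hf hirr hθ c).1 hc
    exact ⟨AdjoinRoot.mk f g, by rw [AdjoinRoot.lift_mk, hg]⟩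
  pow_eq_zero := by
    rw [← Nat.cast_pow, ← map_natCast (AdjoinRoot.of f), ZMod.natCast_self, map_zero]
  dvd_of_pow_mul i hi x hx := by
    obtain ⟨g, rfl⟩ := AdjoinRoot.mk_surjective x
    have hp := (Fact.out : p.Prime)
    have : Nontrivial (ZMod (p ^ r)) := (ZMod.castHom h (ZMod p)).domain_nontrivial
    have hg : AdjoinRoot.mk f g = AdjoinRoot.mk f (g %ₘ f) := by
      rw [AdjoinRoot.mk_eq_mk]
      exact ⟨g /ₘ f, by rw [sub_eq_iff_eq_add, add_comm, modByMonic_add_div g f]⟩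
    have hC : ∀ (j : ℕ), (p : AdjoinRoot f) ^ j = AdjoinRoot.mk f (C ((p : ZMod (p ^ r)) ^ j)) :=
      fun j => by rw [C_pow, map_pow, C_eq_natCast, map_natCast]
    rw [hg] at hx ⊢
    rw [hC, ← map_mul, AdjoinRoot.mk_eq_zero] at hx
    rw [hC]
    refine map_dvd _ ?_
    -- The remainder has degree below that of the monic `f`, so divisibility by `f` forces zero and
    -- the claim becomes coefficientwise.
    have h0 : C ((p : ZMod (p ^ r)) ^ i) * (g %ₘ f) = 0 := by
      by_contra hne
      refine hf.not_dvd_of_degree_lt hne ?_ hx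
      rw [C_mul']
      exact (degree_smul_le _ _).trans_lt (degree_modByMonic_lt g hf)
    rw [C_dvd_iff_dvd_coeff]
    intro n
    refine zmod_dvd_of_pow_mul_eq_zero hp.pos hi ?_
    rw [← coeff_C_mul, h0, coeff_zero]

end AdjoinRoot

/-! ### Teichmüller digits, Frobenius lifts and conjugation -/

namespace ResidueMap

variable {p r q : ℕ} {R K : Type*} [CommRing R] [Field K]
  (F : ResidueMap p r q R K)

include F

theorem isUnit_of_map_ne_zero {x : R} (hx : F.φ x ≠ 0) : IsUnit x := by
  obtain ⟨y, hy⟩ := F.exists_of_pow_eq (F.φ x)⁻¹ (by rw [inv_pow, F.pow_map])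
  obtain ⟨w, hw⟩ : (p : R) ∣ x * y - 1 := by
    rw [← F.map_eq_zero_iff, map_sub, map_mul, hy, mul_inv_cancel₀ hx, map_one, sub_self]
  have hn : IsNilpotent ((p : R) * w) := ⟨r, by rw [mul_pow, F.pow_eq_zero, zero_mul]⟩
  refine isUnit_of_mul_isUnit_left (y := y) ?_
  rw [eq_add_of_sub_eq hw, add_comm]
  exact hn.isUnit_one_add

theorem isNilpotent_iff (x : R) : IsNilpotent x ↔ F.φ x = 0 := by
  refine ⟨fun hx => (hx.map F.φ).eq_zero, fun hx => ?_⟩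
  obtain ⟨y, rfl⟩ := (F.map_eq_zero_iff x).1 hx
  exact ⟨r, by rw [mul_pow, F.pow_eq_zero, zero_mul]⟩

/-- A congruence modulo `p` improves to one modulo `p ^ (k + 1)` after `k` Frobenius powers, and `p
^ r = 0`. -/
theorem pow_eq_pow_of_dvd_sub {x y : R} (h : (p : R) ∣ x - y) {k : ℕ} (hk : r ≤ k) :
    x ^ p ^ k = y ^ p ^ k := by
  obtain ⟨w, hw⟩ := dvd_sub_pow_of_dvd_sub h k
  rw [← sub_eq_zero, hw, ← Nat.sub_add_cancel (show r ≤ k + 1 by omega), pow_add, F.pow_eq_zero,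
    mul_zero, zero_mul]

theorem pow_pow_map (k : ℕ) (x : R) : F.φ x ^ q ^ k = F.φ x := by
  induction k with
  | zero => simp
  | succ k ih => rw [pow_succ, pow_mul, ih, F.pow_map]

theorem eq_of_pow_eq_self {s : ℕ} (hs : 0 < s) {x y : R} (hx : x ^ p ^ s = x) (hy : y ^ p ^ s = y)
    (h : F.φ x = F.φ y) : x = y := by
  have hk : ∀ {z : R}, z ^ p ^ s = z → ∀ k, z ^ p ^ (s * k) = z := fun hz k => by
    induction k with
    | zero => simp
    | succ k ih => rw [mul_add, mul_one, pow_add, pow_mul, ih, hz]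
  rw [← hk hx r, ← hk hy r]
  refine F.pow_eq_pow_of_dvd_sub ?_ (Nat.le_mul_of_pos_left r hs)
  rw [← F.map_eq_zero_iff, map_sub, h, sub_self]

/-- Transport of a residue map along an isomorphism. -/
def compEquiv {R' : Type*} [CommRing R'] (e : R' ≃+* R) : ResidueMap p r q R' K where
  φ := F.φ.comp e
  map_eq_zero_iff x := by
    rw [RingHom.comp_apply, F.map_eq_zero_iff, ← map_natCast (e : R' →+* R)]
    exact map_dvd_iff e
  pow_map x := F.pow_map _
  exists_of_pow_eq c hc := by
    obtain ⟨x, hx⟩ := F.exists_of_pow_eq c hc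
    exact ⟨e.symm x, by simpa using hx⟩
  pow_eq_zero := e.injective (by simpa using F.pow_eq_zero)
  dvd_of_pow_mul i hi x hx := by
    have := F.dvd_of_pow_mul i hi (e x) (by simpa using congrArg e hx)
    rw [← map_dvd_iff e]
    simpa using this

end ResidueMap

/-- Hensel: modulo `p`, `root ^ p ^ m` is a simple root of `f`, whose reduction has coefficients in
the prime field. The exact root `y` near it is the image of `root`. -/
theorem exists_frobenius_lift {p r : ℕ} [Fact p.Prime] {h : p ∣ p ^ r} {f : (ZMod (p ^ r))[X]}
    (hf : f.Monic) (hirr : Irreducible (f.map (ZMod.castHom h (ZMod p)))) {K : Type*} [Field K]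
    [Algebra (ZMod p) K] [CharP K p] {θ : K}
    (hθ : f.eval₂ ((algebraMap (ZMod p) K).comp (ZMod.castHom h (ZMod p))) θ = 0) (m : ℕ) :
    ∃ σ : AdjoinRoot f →+* AdjoinRoot f, ∀ x, (residueMapAdjoinRoot hf hirr hθ).φ (σ x) =
      (residueMapAdjoinRoot hf hirr hθ).φ x ^ p ^ m := by
  set F := residueMapAdjoinRoot hf hirr hθ
  set ι := (algebraMap (ZMod p) K).comp (ZMod.castHom h (ZMod p))
  have hroot : F.φ (AdjoinRoot.root f) = θ := AdjoinRoot.lift_root hθ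
  have hcomp : F.φ.comp (algebraMap (ZMod (p ^ r)) (AdjoinRoot f)) = ι := Subsingleton.elim _ _
  have hfrob : (iterateFrobenius K p m).comp ι = ι := Subsingleton.elim _ _
  have heval : ∀ g : (ZMod (p ^ r))[X], F.φ (aeval (AdjoinRoot.root f ^ p ^ m) g) =
      g.eval₂ ι θ ^ p ^ m := fun g => by
    rw [aeval_def, hom_eval₂, hcomp, map_pow, hroot, ← iterateFrobenius_def, ← iterateFrobenius_def,
      hom_eval₂, hfrob]
  obtain ⟨y, ⟨hy, hy0⟩, -⟩ := existsUnique_nilpotent_sub_and_aeval_eq_zero (P := f)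
    (x := AdjoinRoot.root f ^ p ^ m)
    (by rw [F.isNilpotent_iff, heval, hθ, zero_pow (pow_pos (Fact.out : p.Prime).pos m).ne'])
    (by
      refine F.isUnit_of_map_ne_zero ?_
      rw [heval]
      refine pow_ne_zero _ ?_
      have := (PerfectField.separable_of_irreducible hirr).aeval_derivative_ne_zero (x := θ) (by rw [aeval_def, eval₂_map, hθ])
      rwa [derivative_map, aeval_def, eval₂_map] at this)
  rw [F.isNilpotent_iff, map_sub, map_pow, hroot, sub_eq_zero] at hy
  have hy1 : f.eval₂ (AdjoinRoot.of f) y = 0 := hy0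
  refine ⟨AdjoinRoot.lift (AdjoinRoot.of f) y hy1, fun x => ?_⟩
  obtain ⟨g, rfl⟩ := AdjoinRoot.mk_surjective x
  have h1 : F.φ (AdjoinRoot.mk f g) = g.eval₂ ι θ := AdjoinRoot.lift_mk hθ g
  rw [h1, AdjoinRoot.lift_mk, hom_eval₂, ← hy, ← iterateFrobenius_def, ← iterateFrobenius_def,
    hom_eval₂, hfrob]
  congr 1

namespace ResidueMap

variable {p r s : ℕ} {R K : Type*} [Fact p.Prime] [CommRing R] [Field K]
  (F : ResidueMap p r (p ^ s) R K)

include F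

theorem mem_teichmullerSet_iff (hs : 0 < s) (x : R) :
    x ∈ teichmullerSet p s R ↔ x ^ p ^ s = x := by
  have hp : 0 < p ^ s := pow_pos (Fact.out : p.Prime).pos s
  have hpow : x ^ p ^ s = x ^ (p ^ s - 1) * x := by rw [← pow_succ, Nat.sub_add_cancel hp]
  constructor
  · rintro (rfl | h)
    · exact zero_pow hp.ne'
    · rw [hpow, h, one_mul]
  · intro h
    by_cases h0 : F.φ x = 0
    · exact Or.inl (F.eq_of_pow_eq_self hs h (zero_pow hp.ne') (by rw [h0, map_zero]))
    · right
      have hu := F.isUnit_of_map_ne_zero h0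
      rw [hpow] at h
      exact hu.mul_right_cancel (by rw [h, one_mul])

theorem exists_teichmuller (hs : 0 < s) (x : R) : ∃ t ∈ teichmullerSet p s R, (p : R) ∣ x - t := by
  -- As `x ^ q ≡ x` modulo `p`, the powers `x ^ q ^ k` are constant from `k = r` on.
  refine ⟨x ^ (p ^ s) ^ r, ?_, ?_⟩
  · rw [F.mem_teichmullerSet_iff hs, ← pow_mul, mul_comm, pow_mul, ← pow_mul p]
    refine F.pow_eq_pow_of_dvd_sub ?_ (Nat.le_mul_of_pos_left r hs)
    rw [← F.map_eq_zero_iff, map_sub, map_pow, F.pow_map, sub_self]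
  · rw [← F.map_eq_zero_iff, map_sub, map_pow, F.pow_pow_map, sub_self]

theorem exists_isExpansion (hs : 0 < s) (x : R) : ∃ a : Fin r → R, IsExpansion p r s x a := by
  have key : ∀ k, ∃ a : ℕ → R, (∀ i, a i ∈ teichmullerSet p s R) ∧
      (p : R) ^ k ∣ x - ∑ i ∈ Finset.range k, a i * (p : R) ^ i := by
    intro k
    induction k with
    | zero => exact ⟨fun _ => 0, fun _ => Or.inl rfl, by simp⟩
    | succ k ih =>
      obtain ⟨a, ha, w, hw⟩ := ih
      obtain ⟨t, ht, v, hv⟩ := F.exists_teichmuller hs w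
      refine ⟨fun i => if i = k then t else a i, fun i => ?_, v, ?_⟩
      · dsimp only
        split_ifs
        exacts [ht, ha i]
      · simp only [Finset.sum_range_succ, if_true]
        rw [ Finset.sum_congr rfl (g := fun i => a i * (p : R) ^ i)
          fun i hi => by rw [if_neg (Finset.mem_range.1 hi).ne]]
        linear_combination hw + (p : R) ^ k * hv
  obtain ⟨a, ha, w, hw⟩ := key r
  refine ⟨fun i => a i, fun i => ha i, ?_⟩
  rw [Fin.sum_univ_eq_sum_range fun i => a i * (p : R) ^ i, ← sub_eq_zero, hw, F.pow_eq_zero,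
    zero_mul]

variable {σ : R →+* R} {h : ℕ} (hσ : ∀ x, F.φ (σ x) = F.φ x ^ p ^ h)

include hσ

theorem map_eq_pow_of_mem_teichmullerSet (hs : 0 < s) {t : R} (ht : t ∈ teichmullerSet p s R) :
    σ t = t ^ p ^ h := by
  rw [F.mem_teichmullerSet_iff hs] at ht
  refine F.eq_of_pow_eq_self hs (by rw [← map_pow, ht]) ?_ (by rw [hσ, map_pow])
  rw [← pow_mul, mul_comm, pow_mul, ht]

/-- A lift `σ` of Frobenius acts on Teichmüller digits by `p ^ h`-th powers, whichever expansion was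
chosen. Thus `conj` is a ring homomorphism, and uniqueness of expansions is not needed. -/
theorem conj_eq (hs : 0 < s) (hh : s / 2 = h) (x : R) : conj p r s x = σ x := by
  have hex := F.exists_isExpansion hs x
  rw [conj, dif_pos hex]
  obtain ⟨ha, hx⟩ := hex.choose_spec
  conv_rhs => rw [hx, map_sum]
  refine Finset.sum_congr rfl fun i _ => ?_
  rw [map_mul, map_pow, map_natCast, F.map_eq_pow_of_mem_teichmullerSet hσ hs (ha i), hh]

theorem involutive_of_frobenius_lift (hs : 0 < s) (hh : s = h + h) (x : R) : σ (σ x) = x := by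
  obtain ⟨a, ha, rfl⟩ := F.exists_isExpansion hs x
  simp only [map_sum, map_mul, map_pow, map_natCast]
  refine Finset.sum_congr rfl fun i _ => ?_
  have h1 := F.map_eq_pow_of_mem_teichmullerSet hσ hs (ha i)
  have h2 := (F.mem_teichmullerSet_iff hs (a i)).1 (ha i)
  rw [h1, map_pow, h1, ← pow_mul, ← pow_add, ← hh, h2]

end ResidueMap

/-! ### The counting formulas and the uniqueness criterion -/

open Classical in
theorem selfDual_count {p r s h : ℕ} {R K A : Type*} [Fact p.Prime] [CommRing R] [Field K]
    [CharP K p] [IsAlgClosed K] [AddCommGroup A] [Fintype A] (hr : 0 < r)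
    (hpA : p.Coprime (Fintype.card A)) (F : ResidueMap p r (p ^ s) R K)
    {σ : R →+* R} (hσ : ∀ c, σ (σ c) = c) (hF : ∀ c, F.φ (σ c) = F.φ c ^ p ^ h)
    (hh : ∃ k, p ^ h * p ^ h = (p ^ s) ^ k) {good : ℕ → Prop}
    (hgood : ∀ d, 0 < d → p.Coprime d → (good d ↔ ∃ i, d ∣ (p ^ s) ^ i + p ^ h))
    {SD : Ideal (AddMonoidAlgebra R A) → Prop}
    (hSD : ∀ C : Ideal (AddMonoidAlgebra R A), SD C ↔ (C : Set (AddMonoidAlgebra R A)) =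
      {v | ∀ u ∈ C, ∑ g, u.coeff g * σ (v.coeff g) = 0}) :
    (Odd r → Nat.card {C // SD C} = 0) ∧
    (Even r → ∃ e : ℕ, (e : ℚ) = ∑ d ∈ (AddMonoid.exponent A).divisors,
        ((if good d then 0 else 1 : ℕ) : ℚ) *
          ((numOfOrder A d : ℚ) / (2 * (ordMod d (p ^ s) : ℚ))) ∧
      Nat.card {C // SD C} = (1 + r) ^ e) ∧
    (Even r → ((∀ C, SD C ↔ C = trivialCode R A p r) ↔ good (AddMonoid.exponent A))) := by
  have hq : (p ^ s).Coprime (Fintype.card A) := hpA.pow_left s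
  obtain ⟨h1, h2, h3⟩ := card_selfDual_of_semilinear hpA hq F hσ hF hh
  simp only [← hSD] at h1 h2 h3
  have hMcard : AddMonoid.exponent A ∣ Fintype.card A := AddGroup.exponent_dvd_card
  have hdpos : ∀ {d}, d ∣ AddMonoid.exponent A → 0 < d ∧ p.Coprime d := fun hd =>
    ⟨Nat.pos_of_dvd_of_pos (hd.trans hMcard) Fintype.card_pos,
      hpA.coprime_dvd_right (hd.trans hMcard)⟩
  have hfilter := card_filter_cyclotomicClass hq (b := fun d => ¬ good d)
    (P := fun O => CyclotomicClass.negMul hq (p ^ h) O ≠ O) fun a => by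
      obtain ⟨hd, hpd⟩ := hdpos (AddMonoid.addOrder_dvd_exponent a)
      rw [Ne, negMul_mk_eq_iff, hgood _ hd hpd]
  have hexp : Even r → ∃ e : ℕ, (e : ℚ) = ∑ d ∈ (AddMonoid.exponent A).divisors,
        ((if good d then 0 else 1 : ℕ) : ℚ) *
          ((numOfOrder A d : ℚ) / (2 * (ordMod d (p ^ s) : ℚ))) ∧
      Nat.card {C // SD C} = (1 + r) ^ e := fun hev => by
    obtain ⟨e, he, hcard⟩ := h2 hev
    refine ⟨e, ?_, hcard⟩
    have he' := (congrArg (Nat.cast (R := ℚ)) he).trans hfilter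
    rw [Nat.cast_mul, Nat.cast_ofNat] at he'
    have h2e : (e : ℚ) = 2 * e / 2 := by ring
    rw [h2e, he', Finset.sum_div]
    refine Finset.sum_congr rfl fun d _ => ?_
    by_cases hg : good d
    · simp [hg]
    · simp only [hg, not_false_eq_true, if_true, if_false, Nat.cast_one]
      rw [mul_comm (2 : ℚ), ← div_div, one_mul, one_mul]
  refine ⟨h1, hexp, fun hev => ?_⟩
  obtain ⟨e, he, hcard⟩ := hexp hev
  have htriv : SD (trivialCode R A p r) := h3 hev
  have huniq : (∀ C, SD C ↔ C = trivialCode R A p r) ↔ e = 0 := by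
    have : Nat.card {C // SD C} = 1 ↔ e = 0 := by
      rw [hcard, Nat.pow_eq_one]
      exact or_iff_right (by omega)
    rw [← this, Nat.card_eq_one_iff_unique]
    constructor
    · intro hC
      exact ⟨⟨fun C D => Subtype.ext (((hC C).1 C.2).trans ((hC D).1 D.2).symm)⟩, ⟨_, htriv⟩⟩
    · rintro ⟨hsub, -⟩ C
      exact ⟨fun hC => congrArg Subtype.val (hsub.elim ⟨C, hC⟩ ⟨_, htriv⟩), fun hC => hC ▸ htriv⟩
  obtain ⟨hMpos, hMp⟩ := hdpos dvd_rfl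
  rw [huniq, ← Nat.cast_eq_zero (R := ℚ), he, Finset.sum_eq_zero_iff_of_nonneg
    fun d _ => by positivity]
  constructor
  · intro hall
    by_contra hM
    have h0 := hall _ (Nat.mem_divisors_self _ hMpos.ne')
    rw [if_neg hM, Nat.cast_one, one_mul, div_eq_zero_iff] at h0
    rcases h0 with h0 | h0
    -- A finite abelian group has an element whose order is the exponent, so the term `d = M` is
    -- nonzero unless `M` is good.
    · obtain ⟨a, ha⟩ := AddMonoid.exists_addOrderOf_eq_exponent
        (AddMonoid.ExponentExists.of_finite (G := A))
      have : Nonempty {a : A // addOrderOf a = AddMonoid.exponent A} := ⟨⟨a, ha⟩⟩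
      exact Nat.card_pos.ne' (Nat.cast_eq_zero.1 h0)
    · have := ordMod_pos hMpos (hMp.pow_left s)
      have : (0 : ℚ) < ordMod (AddMonoid.exponent A) (p ^ s) := by exact_mod_cast this
      linarith
  · intro hM d hd
    have hdM := (Nat.mem_divisors.1 hd).1
    obtain ⟨i, hi⟩ := (hgood _ hMpos hMp).1 hM
    have : good d := (hgood d (hdpos hdM).1 (hdpos hdM).2).2 ⟨i, hdM.trans hi⟩
    rw [if_pos this, Nat.cast_zero, zero_mul]

theorem exists_residueMap {p r s : ℕ} [Fact p.Prime] (hs : 0 < s) {R : Type*} [CommRing R]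
    (hR : IsGaloisRing p r s R) :
    ∃ F : ResidueMap p r (p ^ s) R (AlgebraicClosure (ZMod p)), ∀ m, ∃ σ : R →+* R,
      ∀ x, F.φ (σ x) = F.φ x ^ p ^ m := by
  obtain ⟨h, f, hf, rfl, hirr, ⟨e⟩⟩ := hR
  obtain ⟨θ, hθ⟩ := IsAlgClosed.exists_aeval_eq_zero (AlgebraicClosure (ZMod p))
    (f.map (ZMod.castHom h (ZMod p))) (by
      rw [hf.degree_map]
      exact (natDegree_pos_iff_degree_pos.1 hs).ne')
  rw [aeval_def, eval₂_map] at hθ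
  refine ⟨(residueMapAdjoinRoot hf hirr hθ).compEquiv e, fun m => ?_⟩
  obtain ⟨σ, hσ⟩ := exists_frobenius_lift hf hirr hθ m
  refine ⟨(e.symm : _ →+* R).comp (σ.comp (e : R →+* _)), fun x => ?_⟩
  simpa [ResidueMap.compEquiv] using hσ (e x)

end AbelianCode

theorem mainTheorem2 (p r s : ℕ) (hp : p.Prime) (hr : 0 < r) (hs : 0 < s)
    (R : Type*) [CommRing R] (hR : AbelianCode.IsGaloisRing p r s R)
    (A : Type*) [AddCommGroup A] [Fintype A] (hA : Nat.gcd p (Fintype.card A) = 1) :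
    -- the number of Euclidean self-dual codes
    (Odd r → AbelianCode.NEA R A = 0) ∧
    (Even r → ∃ e : ℕ, (e : ℚ) = AbelianCode.euclideanExponent A p s ∧
      AbelianCode.NEA R A = (1 + r) ^ e) ∧
    -- the number of Hermitian self-dual codes
    (Even s → Odd r → AbelianCode.NHA R A p r s = 0) ∧
    (Even s → Even r → ∃ e : ℕ, (e : ℚ) = AbelianCode.hermitianExponent A p s ∧
      AbelianCode.NHA R A p r s = (1 + r) ^ e) ∧
    -- when the trivial code is the only one
    (Even r →
      ((∀ C : Ideal (AddMonoidAlgebra R A),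
          AbelianCode.IsEuclideanSelfDual C ↔ C = AbelianCode.trivialCode R A p r) ↔
        AbelianCode.Good (AddMonoid.exponent A) (p ^ s))) ∧
    (Even s → Even r →
      ((∀ C : Ideal (AddMonoidAlgebra R A),
          AbelianCode.IsHermitianSelfDual p r s C ↔ C = AbelianCode.trivialCode R A p r) ↔
        AbelianCode.OddlyGood (AddMonoid.exponent A) (p ^ (s / 2)))) := by
  have : Fact p.Prime := ⟨hp⟩
  obtain ⟨F, hF⟩ := AbelianCode.exists_residueMap hs hR
  obtain ⟨e1, e2, e3⟩ := AbelianCode.selfDual_count (h := 0) hr hA F (σ := RingHom.id R)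
    (fun _ => rfl) (by simp) ⟨0, by simp⟩
    (good := fun d => AbelianCode.Good d (p ^ s))
    (fun d hd hpd => by rw [AbelianCode.good_iff hd (hpd.pow_left s), pow_zero])
    (SD := AbelianCode.IsEuclideanSelfDual) (fun _ => Iff.rfl)
  rcases Nat.even_or_odd s with hs2 | hs2
  · obtain ⟨σ, hσ⟩ := hF (s / 2)
    obtain ⟨k, hk⟩ := id hs2
    have hk2 : s = s / 2 + s / 2 := by omega
    obtain ⟨h1, h2, h3⟩ := AbelianCode.selfDual_count hr hA F
      (F.involutive_of_frobenius_lift hσ hs hk2) hσ ⟨1, by rw [← pow_add, ← hk2, pow_one]⟩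
      (good := fun d => AbelianCode.OddlyGood d (p ^ (s / 2)))
      (fun d hd hpd => by
        -- With `n = p ^ (s / 2)` one has `n ^ 2 = p ^ s`, because `s` is even.
        rw [AbelianCode.oddlyGood_iff hd (hpd.pow_left _), ← pow_mul, mul_two, ← hk2])
      (SD := AbelianCode.IsHermitianSelfDual (A := A) p r s) (fun C => by
        simp only [AbelianCode.IsHermitianSelfDual, AbelianCode.hermitianForm,
          F.conj_eq hσ hs rfl])
    exact ⟨e1, e2, fun _ => h1, fun _ => h2, e3, fun _ => h3⟩
  · have hs3 := Nat.not_even_iff_odd.2 hs2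
    exact ⟨e1, e2, fun h => absurd h hs3, fun h => absurd h hs3, e3, fun h => absurd h hs3⟩
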